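/- Consider $N$ spins $\Lambda=\{1,\dots,N\}$, each with a $d$-dimensional Hilbert space. An operator is $q$-local if it is a sum $\sum_{X\subseteq\Lambda,\,|X|\le q} o_X$ with $o_X$ supported on $X$ (i.e. acting as the identity outside $X$). Let $k,q\ge 1$ be integers and $g>0$. Let $H=\sum_{X\subseteq\Lambda,\,|X|\le k} h_X$ be a $k$-local, $g$-extensive Hamiltonian: each $h_X$ is Hermitian and supported on $X$, and $\sum_{X\ni i}\|h_X\|\le g$ for every $i\in\Lambda$, where $\|\cdot\|$ is the operator norm. Let $H$ be frustration free with ground state $|\Omega\rangle$, in the sense that $h_X|\Omega\rangle=0$ for every $X$ (so $H|\Omega\rangle=0$); nothing else is required of the vector $|\Omega\rangle$. Put $\lambda:=2gk$ and let $\Pi^H_{\ge x}$ be the orthogonal projection onto the span of the eigenvectors of $H$ with eigenvalue in $[x,\infty)$. Then for every $q$-local operator $A$ and every real $x\ge\lambda q$, $$\bigl\|\Pi^H_{\ge x}A|\Omega\rangle\bigr\|\;\le\;\bigl\|A|\Omega\rangle\bigr\|\left(\frac{x}{\lambda q}\right)^{q/(2k)}\exp\left(-\frac{x}{2k\lambda}+\frac{q}{2k}\right).$$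 -/

import Mathlib

/-- The Hilbert space `(ℂ^d)^{⊗ N}` of `N` spins of local dimension `d`, written in the product
basis: a vector is a square-summable family of amplitudes over the spin configurations
`s : Fin N → Fin d`. -/
abbrev SpinSpace (N d : ℕ) : Type := EuclideanSpace ℂ (Fin N → Fin d)

/-- Operators on the spin system; the norm on this type is the operator norm. -/
abbrev SpinOp (N d : ℕ) : Type := SpinSpace N d →L[ℂ] SpinSpace N d

/-- The matrix element `⟨s|O|t⟩` in the product basis. -/
noncomputable def SpinOp.entry {N d : ℕ} (O : SpinOp N d) (s t : Fin N → Fin d) : ℂ :=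
  O (EuclideanSpace.single t (1 : ℂ)) s

/-- `O` is supported on the set of spins `X`: it has the form `M ⊗ 1`, where `M` is a matrix acting
on the spins in `X` and `1` is the identity on the spins outside `X`. -/
def SpinOp.IsSupportedOn {N d : ℕ} (O : SpinOp N d) (X : Finset (Fin N)) : Prop :=
  ∃ M : Matrix (X → Fin d) (X → Fin d) ℂ, ∀ s t : Fin N → Fin d,
    ((∀ i, i ∉ X → s i = t i) → O.entry s t = M (fun i => s i) (fun i => t i)) ∧
    ((∃ i, i ∉ X ∧ s i ≠ t i) → O.entry s t = 0)

/-- The family `o` writes `O` as `∑_{|X| ≤ q} o_X` with each `o_X` supported on `X`. -/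
structure SpinOp.IsLocalDecomposition {N d : ℕ} (q : ℕ) (O : SpinOp N d)
    (o : Finset (Fin N) → SpinOp N d) : Prop where
  supported : ∀ X, (o X).IsSupportedOn X
  eq_zero_of_lt_card : ∀ X, q < X.card → o X = 0
  sum_eq : O = ∑ X, o X

/-- `O` is `q`-local: a sum of operators each supported on at most `q` spins. -/
def SpinOp.IsLocal {N d : ℕ} (q : ℕ) (O : SpinOp N d) : Prop :=
  ∃ o : Finset (Fin N) → SpinOp N d, SpinOp.IsLocalDecomposition q O o

/-- A family of local terms is `g`-extensive: `∑_{X ∋ i} ‖o_X‖ ≤ g` for every spin `i`. -/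
def SpinOp.IsExtensive {N d : ℕ} (g : ℝ) (o : Finset (Fin N) → SpinOp N d) : Prop :=
  ∀ i : Fin N, ∑ X with i ∈ X, ‖o X‖ ≤ g

/-- `H = ∑_{|X| ≤ k} h_X` is a `k`-local, `g`-extensive Hamiltonian with Hermitian local terms
`h_X`, and it is frustration free with respect to `Ω`: each term satisfies `h_X Ω = 0`. -/
structure SpinOp.IsFrustrationFree {N d : ℕ} (k : ℕ) (g : ℝ) (H : SpinOp N d)
    (h : Finset (Fin N) → SpinOp N d) (Ω : SpinSpace N d) : Prop where
  isLocalDecomposition : SpinOp.IsLocalDecomposition k H h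
  isExtensive : SpinOp.IsExtensive g h
  isSelfAdjoint : ∀ X, IsSelfAdjoint (h X)
  apply_eq_zero : ∀ X, h X Ω = 0

/-- The span of the eigenvectors of `O` whose eigenvalue lies in `[x, ∞)`. -/
def SpinOp.spectralSubspaceGE {N d : ℕ} (O : SpinOp N d) (x : ℝ) : Submodule ℂ (SpinSpace N d) :=
  ⨆ (μ : ℝ) (_ : x ≤ μ),
    Module.End.eigenspace (O : SpinSpace N d →ₗ[ℂ] SpinSpace N d) (μ : ℂ)

/-- The spectral projection `Π^O_{≥ x}`. -/
noncomputable def SpinOp.spectralProjGE {N d : ℕ} (O : SpinOp N d) (x : ℝ) : SpinOp N d :=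
  (O.spectralSubspaceGE x).starProjection

/-- The energy scale `λ = 2 g k`. -/
def energyScale (g : ℝ) (k : ℕ) : ℝ := 2 * g * k

open scoped InnerProductSpace

/-! ### Commuting contractions and weighted sums of them -/

section Abstract

variable {E : Type*} [NormedAddCommGroup E] [InnerProductSpace ℂ E]

/-! Rescale each local term to a contraction `T X`. Terms on disjoint sets commute, so a term acting
on `Z` leaves untouched the annihilation of `Ω` by every `T X` with `X` disjoint from `Z`. Hence `A
Ω` carries at most `q` excitations and each application of `H` adds at most `k`
(`IsExcitedAtMost.apply`).

On a vector with at most `n` excitations, a disjoint family of terms is jointly diagonalizable with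
at most `n` nonzero eigenvalues, so its sum has gain at most `n`. Splitting the weights `‖h X‖` into
disjoint families of total weight `g * k` gives `‖H φ‖ ≤ g * k * n * ‖φ‖` (`norm_weighted_sum_le`).

Iterating bounds the moments of the energy distribution of `A Ω` by rising factorials, as for a
Gamma law, and a Chernoff bound (`sum_filter_le_of_moments`) gives the tail. The terms need not be
positive. -/

theorem ContinuousLinearMap.list_prod_apply_of_eigenvector {J : Type*} (T : J → E →L[ℂ] E)
    (γ : J → ℂ) (v : E) (hv : ∀ j, T j v = γ j • v) (l : List J) :
    (l.map T).prod v = (l.map γ).prod • v := by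
  induction l with
  | nil => simp
  | cons j l ih =>
    simp [ih, hv, smul_smul, mul_comm]

/-- The products of `T` over lists of pairwise disjoint sets annihilate `ψ` as soon as the list
contains the empty set or more than `n` sets. -/
def IsExcitedAtMost {ι : Type*} (T : Finset ι → E →L[ℂ] E) (n : ℕ) (ψ : E) : Prop :=
  ∀ l : List (Finset ι), l.Pairwise Disjoint → (∅ ∈ l ∨ n < l.length) → (l.map T).prod ψ = 0

variable [FiniteDimensional ℂ E]

/-- If commuting self-adjoint contractions are such that the product of any `q + 1` distinct ones
annihilates `ψ`, then their sum stretches `ψ` by a factor of at most `q`. -/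
theorem ContinuousLinearMap.norm_sum_apply_le_of_commute {J : Type*} [Fintype J]
    (T : J → E →L[ℂ] E) (hT : ∀ j, IsSelfAdjoint (T j))
    (hcomm : Pairwise fun i j => Commute (T i) (T j))
    (hnorm : ∀ j, ‖T j‖ ≤ 1) (q : ℕ) (ψ : E)
    (hψ : ∀ l : List J, l.Nodup → q < l.length → (l.map T).prod ψ = 0) :
    ‖∑ j, T j ψ‖ ≤ q * ‖ψ‖ := by
  classical
  have hsymm : ∀ j, (T j : E →ₗ[ℂ] E).IsSymmetric := fun j =>
    ContinuousLinearMap.isSelfAdjoint_iff_isSymmetric.mp (hT j)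
  have htop := LinearMap.IsSymmetric.iSup_iInf_eq_top_of_commute hsymm (fun i j hij => by
    have := hcomm hij
    ext v
    exact congrArg (fun S : E →L[ℂ] E => S v) this.eq)
  have hort := LinearMap.IsSymmetric.orthogonalFamily_iInf_eigenspaces hsymm
  have hmem : ψ ∈ ⨆ γ : J → ℂ, ⨅ j, Module.End.eigenspace (T j : E →ₗ[ℂ] E) (γ j) := by
    rw [htop]; trivial
  obtain ⟨f, hf, hfs⟩ := (Submodule.mem_iSup_iff_exists_finsupp _ _).mp hmem
  have hev : ∀ γ j, T j (f γ) = γ j • f γ := fun γ j =>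
    Module.End.mem_eigenspace_iff.mp ((Submodule.mem_iInf _).mp (hf γ) j)
  have hsq : ∀ c : (J → ℂ) → ℂ,
      ‖∑ γ ∈ f.support, c γ • f γ‖ ^ 2 = ∑ γ ∈ f.support, ‖c γ‖ ^ 2 * ‖f γ‖ ^ 2 := fun c => by
    have := hort.norm_sum (fun γ => c γ • (⟨f γ, hf γ⟩ :
      ↥(⨅ j, Module.End.eigenspace (T j : E →ₗ[ℂ] E) (γ j)))) f.support
    simpa [norm_smul, mul_pow] using this
  have hψs : ψ = ∑ γ ∈ f.support, f γ := hfs.symm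
  -- Each joint eigenvalue has modulus at most 1, and at most `q` of them are nonzero.
  have hcard : ∀ γ ∈ f.support, ‖∑ j, γ j‖ ≤ q := by
    intro γ hγ
    have hγ0 : f γ ≠ 0 := by simpa using hγ
    have hle : ∀ j, ‖γ j‖ ≤ if γ j = 0 then 0 else 1 := by
      intro j
      split_ifs with h
      · simp [h]
      · have h1 : ‖γ j‖ * ‖f γ‖ ≤ 1 * ‖f γ‖ := by
          rw [← norm_smul, ← hev]
          exact (T j).le_of_opNorm_le (hnorm j) _
        exact le_of_mul_le_mul_right h1 (norm_pos_iff.mpr hγ0)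
    have hS : (Finset.univ.filter fun j => γ j ≠ 0).card ≤ q := by
      by_contra! hlt
      -- The product over `S` kills `ψ`, hence by orthogonality every joint eigencomponent of `ψ`;
      -- yet it multiplies `f γ` by a nonzero scalar.
      set S := Finset.univ.filter fun j => γ j ≠ 0 with hSdef
      have h0 := hψ S.toList S.nodup_toList (by simpa using hlt)
      rw [hψs, map_sum, Finset.sum_congr rfl fun δ _ =>
        ContinuousLinearMap.list_prod_apply_of_eigenvector T δ (f δ) (hev δ) S.toList] at h0
      have h1 := hsq fun δ => (S.toList.map δ).prod
      rw [h0, norm_zero, zero_pow two_ne_zero, eq_comm,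
        Finset.sum_eq_zero_iff_of_nonneg (fun _ _ => by positivity)] at h1
      have h2 := h1 γ hγ
      simp only [mul_eq_zero, pow_eq_zero_iff two_ne_zero, norm_eq_zero, hγ0, or_false,
        Finset.prod_map_toList, Finset.prod_eq_zero_iff] at h2
      obtain ⟨j, hj, hj0⟩ := h2
      exact (Finset.mem_filter.mp hj).2 hj0
    calc ‖∑ j, γ j‖ ≤ ∑ j, ‖γ j‖ := norm_sum_le _ _
      _ ≤ ∑ j, if γ j = 0 then (0 : ℝ) else 1 := Finset.sum_le_sum fun j _ => hle j
      _ = ((Finset.univ.filter fun j => γ j ≠ 0).card : ℝ) := by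
        rw [Finset.card_filter]; push_cast
        exact Finset.sum_congr rfl fun j _ => by by_cases h : γ j = 0 <;> simp [h]
      _ ≤ q := by exact_mod_cast hS
  have hsum : ∑ j, T j ψ = ∑ γ ∈ f.support, (∑ j, γ j) • f γ := by
    simp_rw [hψs, map_sum, hev, Finset.sum_smul]
    exact Finset.sum_comm
  refine le_of_sq_le_sq ?_ (by positivity)
  have h1 := hsq fun _ => 1
  simp only [one_smul, norm_one, one_pow, one_mul] at h1
  rw [← hψs] at h1
  rw [hsum, hsq, mul_pow, h1, Finset.mul_sum]
  gcongr with γ hγ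
  exact hcard γ hγ

theorem norm_sum_le_of_pairwiseDisjoint {ι : Type*} [DecidableEq ι] (T : Finset ι → E →L[ℂ] E)
    (hT : ∀ X, IsSelfAdjoint (T X)) (hcomm : ∀ X Y, Disjoint X Y → Commute (T X) (T Y))
    (hnorm : ∀ X, ‖T X‖ ≤ 1) {q : ℕ} {ψ : E} (hψ : IsExcitedAtMost T q ψ)
    (M : Finset (Finset ι)) (hM : ∀ X ∈ M, ∀ Y ∈ M, X ≠ Y → Disjoint X Y) :
    ‖∑ X ∈ M, T X ψ‖ ≤ q * ‖ψ‖ := by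
  rw [← Finset.sum_coe_sort]
  refine ContinuousLinearMap.norm_sum_apply_le_of_commute (fun X : M => T X) (fun X => hT X)
    (fun X Y hXY => hcomm _ _ (hM _ X.2 _ Y.2 (Subtype.coe_ne_coe.mpr hXY)))
    (fun X => hnorm X) q ψ (fun l hl hq => ?_)
  have := hψ (l.map Subtype.val) (by
    rw [List.pairwise_map]
    exact hl.imp fun {X Y} hXY => hM _ X.2 _ Y.2 (Subtype.coe_ne_coe.mpr hXY))
    (Or.inr (by simpa using hq))
  simpa [Function.comp_def] using this

/-- Weighted version of the previous bound: the weights are peeled off along maximal families of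
pairwise disjoint sets. -/
theorem norm_weighted_sum_le {ι : Type*} [DecidableEq ι] [Fintype ι] (T : Finset ι → E →L[ℂ] E)
    (hT : ∀ X, IsSelfAdjoint (T X)) (hcomm : ∀ X Y, Disjoint X Y → Commute (T X) (T Y))
    (hnorm : ∀ X, ‖T X‖ ≤ 1) {q : ℕ} {ψ : E} (hψ : IsExcitedAtMost T q ψ)
    (w : Finset ι → ℝ) (hw : ∀ X, 0 ≤ w X) (hw0 : w ∅ = 0) (D : ℝ) (hD : 0 ≤ D)
    (hwD : ∀ X, w X ≠ 0 → ∑ Y with ¬ Disjoint X Y, w Y ≤ D) :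
    ‖∑ X, (w X : ℂ) • T X ψ‖ ≤ D * (q * ‖ψ‖) := by
  induction hn : (Finset.univ.filter fun X => w X ≠ 0).card using Nat.strong_induction_on
    generalizing w D with
  | _ n ih =>
  set S := Finset.univ.filter fun X => w X ≠ 0 with hS
  rcases S.eq_empty_or_nonempty with hemp | hne
  · have : ∀ X, w X = 0 := fun X => by
      by_contra h
      have : X ∈ S := by simp [hS, h]
      simp [hemp] at this
    simp only [this, Complex.ofReal_zero, zero_smul, Finset.sum_const_zero, norm_zero]
    positivity
  · let P : Finset (Finset (Finset ι)) :=
      S.powerset.filter fun M => ∀ X ∈ M, ∀ Y ∈ M, X ≠ Y → Disjoint X Y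
    have hP : P.Nonempty := ⟨∅, by simp [P]⟩
    obtain ⟨M, hMP, hmax⟩ := P.exists_max_image Finset.card hP
    have hMS : M ⊆ S := by simpa using (Finset.mem_filter.mp hMP).1
    have hMd := (Finset.mem_filter.mp hMP).2
    have hSne : ∀ X ∈ S, X.Nonempty := fun X hX => by
      rw [Finset.nonempty_iff_ne_empty]
      rintro rfl
      simp [hS, hw0] at hX
    have hmeet : ∀ X ∈ S, ∃ Y ∈ M, ¬ Disjoint X Y := by
      intro X hX
      by_contra! hcon
      have hXM : X ∉ M := fun h => by
        have := hcon X h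
        rw [disjoint_self] at this
        exact (hSne X hX).ne_empty this
      have hins : insert X M ∈ P := by
        refine Finset.mem_filter.mpr ⟨Finset.mem_powerset.mpr (Finset.insert_subset hX hMS), ?_⟩
        intro A hA B hB hAB
        rw [Finset.mem_insert] at hA hB
        rcases hA with rfl | hA <;> rcases hB with rfl | hB
        · exact absurd rfl hAB
        · exact hcon _ hB
        · exact (hcon _ hA).symm
        · exact hMd _ hA _ hB hAB
      have := hmax _ hins
      rw [Finset.card_insert_of_notMem hXM] at this
      omega
    have hMne : M.Nonempty := by
      obtain ⟨X, hX⟩ := hne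
      obtain ⟨Y, hY, -⟩ := hmeet X hX
      exact ⟨Y, hY⟩
    -- Subtracting the least weight `c` on `M` keeps all weights nonnegative and removes `Z` from
    -- the support. By maximality every set in the support meets `M`, so the neighbourhood bound
    -- drops from `D` to `D - c`, which pays exactly for the layer removed.
    obtain ⟨Z, hZM, hZmin⟩ := M.exists_min_image w hMne
    set c := w Z with hc
    have hZ0 : w Z ≠ 0 := by simpa [hS] using hMS hZM
    have hcD : c ≤ D := by
      refine le_trans ?_ (hwD Z hZ0)
      exact Finset.single_le_sum (f := w) (fun Y _ => hw Y) (by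
        simpa using (hSne Z (hMS hZM)).ne_empty)
    set w' : Finset ι → ℝ := fun X => w X - if X ∈ M then c else 0 with hw'
    have hsub : ∀ X, w' X ≠ 0 → X ∈ S := by
      intro X hX
      by_contra hXS
      have hXM : X ∉ M := fun h => hXS (hMS h)
      have h0 : w X = 0 := by simpa [hS] using hXS
      simp [hw', hXM, h0] at hX
    have hw'nonneg : ∀ X, 0 ≤ w' X := fun X => by
      by_cases h : X ∈ M
      · simpa [hw', h] using hZmin X h
      · simpa [hw', h] using hw X
    have hw'0 : w' ∅ = 0 := by
      by_contra h
      exact (hSne _ (hsub _ h)).ne_empty rfl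
    have hcard : (Finset.univ.filter fun X => w' X ≠ 0).card < n := by
      rw [← hn]
      refine Finset.card_lt_card ⟨fun X hX => hsub X (by simpa using hX), fun h => ?_⟩
      have := h (hMS hZM)
      simp [hw', hZM, hc] at this
    have hkey := ih _ hcard w' hw'nonneg hw'0 (D - c) (by linarith) (fun X hX => by
      have hXS := hsub X hX
      obtain ⟨Y, hYM, hXY⟩ := hmeet X hXS
      have h1 := hwD X (by simpa [hS] using hXS)
      have h2 : c ≤ ∑ Y with ¬ Disjoint X Y, if Y ∈ M then c else 0 := by
        have := Finset.single_le_sum (f := fun Y => if Y ∈ M then c else 0)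
          (s := Finset.univ.filter fun Y => ¬ Disjoint X Y)
          (fun Y _ => by split_ifs; exacts [hw Z, le_rfl]) (a := Y) (by simpa using hXY)
        simpa [hYM] using this
      simp only [hw', Finset.sum_sub_distrib]
      linarith) rfl
    have hsplit : ∑ X, (w X : ℂ) • T X ψ =
        ∑ X, (w' X : ℂ) • T X ψ + (c : ℂ) • ∑ X ∈ M, T X ψ := by
      have hind : (c : ℂ) • ∑ X ∈ M, T X ψ = ∑ X, (if X ∈ M then (c : ℂ) else 0) • T X ψ := by
        simp [Finset.smul_sum, ite_smul]
      rw [hind, ← Finset.sum_add_distrib]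
      refine Finset.sum_congr rfl fun X _ => ?_
      rw [← add_smul]
      by_cases h : X ∈ M <;> simp [hw', h]
    rw [hsplit]
    calc _ ≤ (D - c) * (q * ‖ψ‖) + c * (q * ‖ψ‖) := by
          refine (norm_add_le _ _).trans (add_le_add hkey ?_)
          rw [norm_smul, Complex.norm_real, Real.norm_of_nonneg (hw Z)]
          exact mul_le_mul_of_nonneg_left
            (norm_sum_le_of_pairwiseDisjoint T hT hcomm hnorm hψ M hMd) (hw Z)
      _ = D * (q * ‖ψ‖) := by ring

end Abstract

/-! ### Matrix elements and supports -/

namespace SpinOp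

variable {N d : ℕ}

theorem apply_eq_sum_entry (O : SpinOp N d) (v : SpinSpace N d) (s : Fin N → Fin d) :
    O v s = ∑ t, O.entry s t * v t := by
  have hv : v = ∑ t, v t • EuclideanSpace.single t (1 : ℂ) := by
    ext s
    simp [Pi.single_apply]
  conv_lhs => rw [hv]
  simp [entry, mul_comm]

theorem entry_mul (O O' : SpinOp N d) (s t : Fin N → Fin d) :
    (O * O').entry s t = ∑ u, O.entry s u * O'.entry u t :=
  apply_eq_sum_entry O _ s

theorem ext_entry {O O' : SpinOp N d} (h : ∀ s t, O.entry s t = O'.entry s t) : O = O' := by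
  ext v s
  simp [apply_eq_sum_entry, h]

/-- The product of two operators with disjoint supports factorizes entrywise. -/
theorem IsSupportedOn.entry_mul_of_disjoint {O O' : SpinOp N d} {X Y : Finset (Fin N)}
    (hXY : Disjoint X Y) {M : Matrix (X → Fin d) (X → Fin d) ℂ}
    {M' : Matrix (Y → Fin d) (Y → Fin d) ℂ}
    (hM : ∀ s t : Fin N → Fin d,
      ((∀ i, i ∉ X → s i = t i) → O.entry s t = M (fun i => s i) (fun i => t i)) ∧
      ((∃ i, i ∉ X ∧ s i ≠ t i) → O.entry s t = 0))
    (hM' : ∀ s t : Fin N → Fin d,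
      ((∀ i, i ∉ Y → s i = t i) → O'.entry s t = M' (fun i => s i) (fun i => t i)) ∧
      ((∃ i, i ∉ Y ∧ s i ≠ t i) → O'.entry s t = 0)) (s t : Fin N → Fin d) :
    (O * O').entry s t = if ∀ i, i ∉ X → i ∉ Y → s i = t i then
      M (fun i => s i) (fun i => t i) * M' (fun i => s i) (fun i => t i) else 0 := by
  have hnot : ∀ i ∈ Y, i ∉ X := fun i hY hX => Finset.disjoint_left.mp hXY hX hY
  rw [entry_mul]
  split_ifs with hst
  -- The only intermediate configuration that contributes: `O` changes spins in `X` only, `O'` only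
  -- outside `X`.
  · rw [Finset.sum_eq_single (fun i => if i ∈ X then t i else s i)]
    · rw [(hM _ _).1 (fun i hi => by simp [hi]),
        (hM' _ _).1 (fun i hi => by by_cases h : i ∈ X <;> simp [h]; exact hst i h hi)]
      congr 2 <;> funext i
      · simp
      · simp [hnot i i.2]
    · intro u _ hu
      obtain ⟨i, hi⟩ := Function.ne_iff.mp hu
      by_cases h : i ∈ X
      · rw [(hM' _ _).2 ⟨i, Finset.disjoint_left.mp hXY h, by simpa [h] using hi⟩, mul_zero]
      · rw [(hM _ _).2 ⟨i, h, by simpa [h, eq_comm] using hi⟩, zero_mul]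
    · simp
  · push Not at hst
    obtain ⟨i, hX, hY, hi⟩ := hst
    refine Finset.sum_eq_zero fun u _ => ?_
    by_cases h : s i = u i
    · rw [(hM' _ _).2 ⟨i, hY, h ▸ hi⟩, mul_zero]
    · rw [(hM _ _).2 ⟨i, hX, h⟩, zero_mul]

theorem IsSupportedOn.commute {O O' : SpinOp N d} {X Y : Finset (Fin N)}
    (hO : O.IsSupportedOn X) (hO' : O'.IsSupportedOn Y) (hXY : Disjoint X Y) : Commute O O' := by
  obtain ⟨M, hM⟩ := hO
  obtain ⟨M', hM'⟩ := hO'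
  refine ext_entry fun s t => ?_
  rw [entry_mul_of_disjoint hXY hM hM', entry_mul_of_disjoint hXY.symm hM' hM, mul_comm]
  congr 1
  exact propext ⟨fun h i hY hX => h i hX hY, fun h i hX hY => h i hY hX⟩

theorem IsSupportedOn.smul {O : SpinOp N d} {X : Finset (Fin N)} (hO : O.IsSupportedOn X) (c : ℂ) :
    (c • O).IsSupportedOn X := by
  obtain ⟨M, hM⟩ := hO
  refine ⟨c • M, fun s t => ⟨fun h => ?_, fun h => ?_⟩⟩
  · simpa [entry] using Or.inl ((hM s t).1 h)
  · simpa [entry] using Or.inr ((hM s t).2 h)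

end SpinOp

/-! ### Counting excitations -/

section Excitations

variable {E : Type*} [NormedAddCommGroup E] [InnerProductSpace ℂ E] {ι : Type*}

theorem IsExcitedAtMost.sum {T : Finset ι → E →L[ℂ] E} {n : ℕ} {J : Type*} {s : Finset J}
    {ψ : J → E} (h : ∀ j ∈ s, IsExcitedAtMost T n (ψ j)) :
    IsExcitedAtMost T n (∑ j ∈ s, ψ j) := fun l hl hn => by
  rw [map_sum]
  exact Finset.sum_eq_zero fun j hj => h j hj l hl hn

theorem IsExcitedAtMost.zero (T : Finset ι → E →L[ℂ] E) (n : ℕ) : IsExcitedAtMost T n 0 :=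
  fun _ _ _ => map_zero _

/-- Only `#Z` pairwise disjoint sets can meet `Z`. -/
theorem length_le_card_of_pairwise_disjoint [DecidableEq ι] (Z : Finset ι) :
    ∀ l : List (Finset ι), l.Pairwise Disjoint → (∀ X ∈ l, ¬ Disjoint Z X) → l.length ≤ Z.card
  | [], _, _ => by simp
  | X :: l, hl, hZ => by
    rw [List.pairwise_cons] at hl
    have hX : (Z ∩ X).Nonempty := by
      rw [Finset.nonempty_iff_ne_empty, Ne, ← Finset.disjoint_iff_inter_eq_empty]
      exact hZ X (by simp)
    have ih := length_le_card_of_pairwise_disjoint (Z \ X) l hl.2 (fun Y hY hd => by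
      refine hZ Y (by simp [hY]) ?_
      rw [Finset.disjoint_left] at hd ⊢
      intro i hiZ hiY
      exact hd (Finset.mem_sdiff.mpr ⟨hiZ, fun hiX =>
        Finset.disjoint_left.mp (hl.1 Y hY) hiX hiY⟩) hiY)
    have := Finset.card_sdiff_add_card_inter Z X
    have := hX.card_pos
    simp only [List.length_cons]
    omega

/-- If some factor of a product over pairwise disjoint sets annihilates `φ`, so does the product. -/
theorem list_prod_apply_eq_zero {T : Finset ι → E →L[ℂ] E}
    (hcomm : ∀ X Y, Disjoint X Y → Commute (T X) (T Y)) {φ : E} {X : Finset ι} (hX : T X φ = 0) :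
    ∀ l : List (Finset ι), l.Pairwise Disjoint → X ∈ l → (l.map T).prod φ = 0
  | [], _, h => by simp at h
  | Y :: l, hl, h => by
    rw [List.pairwise_cons] at hl
    rcases List.mem_cons.mp h with rfl | h
    · have hc : Commute (T X) (l.map T).prod := Commute.list_prod_right _ _ (fun S hS => by
        obtain ⟨Y, hY, rfl⟩ := List.mem_map.mp hS
        exact hcomm _ _ (hl.1 Y hY))
      rw [List.map_cons, List.prod_cons, hc.eq]
      change (l.map T).prod (T X φ) = 0
      rw [hX, map_zero]
    · change T Y ((l.map T).prod φ) = 0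
      rw [list_prod_apply_eq_zero hcomm hX l hl.2 h, map_zero]

/-- An operator commuting with all `T X`, `X` disjoint from `Z`, creates at most `#Z`
excitations. -/
theorem IsExcitedAtMost.apply [DecidableEq ι] {T : Finset ι → E →L[ℂ] E}
    (hcomm : ∀ X Y, Disjoint X Y → Commute (T X) (T Y)) {n : ℕ} {ψ : E}
    (hψ : IsExcitedAtMost T n ψ) (B : E →L[ℂ] E) (Z : Finset ι)
    (hB : ∀ X, Disjoint Z X → Commute (T X) B) {m : ℕ} (hm : n + Z.card ≤ m) :
    IsExcitedAtMost T m (B ψ) := by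
  intro l hl hn
  -- The factors disjoint from `Z` are moved to the right, past `B`, to act on `ψ`; at most `Z.card`
  -- factors are lost to the left.
  have hperm := List.filter_append_perm (fun X => decide (¬ Disjoint Z X)) l
  set l₁ := l.filter fun X => decide (¬ Disjoint Z X)
  set l₂ := l.filter fun X => !decide (¬ Disjoint Z X) with hl₂
  have hmem₂ : ∀ X, X ∈ l₂ ↔ X ∈ l ∧ Disjoint Z X := fun X => by simp [hl₂]
  have hprod : (l.map T).prod = (l₁.map T).prod * (l₂.map T).prod := by
    rw [← List.prod_append, ← List.map_append]
    refine (List.Perm.prod_eq' (hperm.map T).symm ?_)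
    rw [List.pairwise_map]
    exact hl.imp fun h => hcomm _ _ h
  have hB₂ : Commute (l₂.map T).prod B := Commute.list_prod_left _ _ (fun S hS => by
    obtain ⟨Y, hY, rfl⟩ := List.mem_map.mp hS
    exact hB _ ((hmem₂ Y).mp hY).2)
  have hlen : l₁.length ≤ Z.card :=
    length_le_card_of_pairwise_disjoint Z l₁ (hl.filter _) (fun X hX => by
      simpa using (List.mem_filter.mp hX).2)
  have h0 : (l₂.map T).prod ψ = 0 := by
    refine hψ l₂ (hl.filter _) ?_
    rcases hn with hn | hn
    -- The empty set is disjoint from `Z`, so it stays among the factors that reach `ψ`.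
    · exact Or.inl ((hmem₂ _).mpr ⟨hn, by simp⟩)
    · right
      have := hperm.length_eq
      rw [List.length_append] at this
      omega
  have : (l.map T).prod * B = (l₁.map T).prod * B * (l₂.map T).prod := by
    rw [hprod, mul_assoc, hB₂.eq, mul_assoc]
  change ((l.map T).prod * B) ψ = 0
  rw [this]
  change ((l₁.map T).prod * B) ((l₂.map T).prod ψ) = 0
  rw [h0, map_zero]

theorem IsExcitedAtMost.of_apply_eq_zero {T : Finset ι → E →L[ℂ] E}
    (hcomm : ∀ X Y, Disjoint X Y → Commute (T X) (T Y)) {Ω : E} (hΩ : ∀ X, T X Ω = 0) :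
    IsExcitedAtMost T 0 Ω := by
  intro l hl hn
  obtain ⟨X, hX⟩ : ∃ X, X ∈ l := by
    rcases hn with hn | hn
    · exact ⟨_, hn⟩
    · exact List.exists_mem_of_length_pos hn
  exact list_prod_apply_eq_zero hcomm (hΩ X) l hl hX

end Excitations

/-! ### Chernoff bound for Gamma-type moments -/

/-- The binomial series for exponent `-a`, with its coefficients as rising factorials so that it
sums the moment bounds term by term. -/
theorem Real.hasSum_one_div_one_sub_rpow {a u : ℝ} (hu : 0 ≤ u) (hu1 : u < 1) :
    HasSum (fun m : ℕ => (∏ j ∈ Finset.range m, (a + j)) / m.factorial * u ^ m)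
      (1 / (1 - u) ^ a) := by
  have h := (Real.one_div_one_sub_rpow_hasFPowerSeriesOnBall_zero a).hasSum (y := u) (by
    rw [Metric.mem_eball, edist_zero_right, Real.enorm_of_nonneg hu]
    exact ENNReal.ofReal_lt_one.mpr hu1)
  rw [zero_add] at h
  suffices hfun : (fun m : ℕ => (∏ j ∈ Finset.range m, (a + j)) / m.factorial * u ^ m) =
      fun m => FormalMultilinearSeries.ofScalars ℝ (fun n : ℕ => Ring.choose (a + n - 1) n) m
        fun _ => u by
    rw [hfun]
    exact h
  funext m
  rw [FormalMultilinearSeries.ofScalars_apply_eq, ← Ring.multichoose_eq, smul_eq_mul]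
  have h2 : (ascPochhammer ℝ m).eval a = ∏ j ∈ Finset.range m, (a + j) := by
    clear * -
    induction m with
    | zero => simp
    | succ m ih => rw [ascPochhammer_succ_eval, Finset.prod_range_succ, ih]
  have h1 := Ring.factorial_nsmul_multichoose_eq_ascPochhammer a m
  rw [Polynomial.ascPochhammer_smeval_eq_eval] at h1
  rw [← h2, ← h1, nsmul_eq_mul, mul_div_cancel_left₀ _ (by exact_mod_cast m.factorial_ne_zero)]

/-- Chernoff bound from moments growing like those of a Gamma distribution. -/
theorem sum_filter_le_of_moments {J : Type*} [Fintype J] (p e : J → ℝ) (hp : ∀ i, 0 ≤ p i)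
    {C lam k q x : ℝ} (hlam : 0 < lam) (hk : 0 < k) (hq : 0 < q)
    (hmom : ∀ m : ℕ, ∑ i, p i * e i ^ m ≤ C * ∏ j ∈ Finset.range m, (lam * (q + k * j)))
    (hx : lam * q ≤ x) :
    ∑ i with x ≤ e i, p i ≤
      C * ((x / (lam * q)) ^ (q / k) * Real.exp (-(x / (k * lam)) + q / k)) := by
  have hlq : 0 < lam * q := by positivity
  have hx0 : 0 < x := hlq.trans_le hx
  -- Minimizer of `exp (-t * x) * (1 - u) ^ (-q / k)` with `u = k * lam * t`; `hx` makes it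
  -- nonnegative.
  set u : ℝ := 1 - lam * q / x with hu
  have hu0 : 0 ≤ u := by
    have : lam * q / x ≤ 1 := (div_le_one hx0).mpr hx
    linarith
  have hu1 : u < 1 := by
    have : 0 < lam * q / x := by positivity
    linarith
  set t : ℝ := u / (k * lam) with ht
  have ht0 : 0 ≤ t := by positivity
  have hexp : HasSum (fun m : ℕ => ∑ i, p i * ((t * e i) ^ m / m.factorial))
      (∑ i, p i * Real.exp (t * e i)) := by
    refine hasSum_sum fun i _ => HasSum.mul_left _ ?_
    rw [Real.exp_eq_exp_ℝ]
    exact NormedSpace.expSeries_div_hasSum_exp (t * e i)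
  have hbin := (Real.hasSum_one_div_one_sub_rpow (a := q / k) hu0 hu1).mul_left C
  have hle : ∑ i, p i * Real.exp (t * e i) ≤ C * (1 / (1 - u) ^ (q / k)) := by
    refine hasSum_le (fun m => ?_) hexp hbin
    have h1 : ∑ i, p i * ((t * e i) ^ m / m.factorial) =
        t ^ m / m.factorial * ∑ i, p i * e i ^ m := by
      rw [Finset.mul_sum]
      exact Finset.sum_congr rfl fun i _ => by rw [mul_pow]; ring
    have h2 : ∏ j ∈ Finset.range m, (lam * (q + k * j)) =
        (k * lam) ^ m * ∏ j ∈ Finset.range m, (q / k + j) := by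
      rw [← Finset.card_range m, ← Finset.prod_const, Finset.card_range, ← Finset.prod_mul_distrib]
      exact Finset.prod_congr rfl fun j _ => by field_simp
    rw [h1]
    refine (mul_le_mul_of_nonneg_left (hmom m) (by positivity)).trans_eq ?_
    have h3 : u = t * (k * lam) := by rw [ht]; field_simp
    rw [h2, h3]
    simp only [mul_pow]
    ring
  have hmarkov : Real.exp (t * x) * ∑ i with x ≤ e i, p i ≤ ∑ i, p i * Real.exp (t * e i) := by
    rw [Finset.mul_sum]
    refine (Finset.sum_le_sum fun i hi => ?_).trans (Finset.sum_le_univ_sum_of_nonneg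
      (fun i => mul_nonneg (hp i) (Real.exp_pos _).le))
    have hi' : x ≤ e i := (Finset.mem_filter.mp hi).2
    rw [mul_comm]
    have := hp i
    gcongr
  have h1u : 1 / (1 - u) ^ (q / k) = (x / (lam * q)) ^ (q / k) := by
    rw [hu, sub_sub_cancel, one_div, ← Real.inv_rpow (by positivity), inv_div]
  have htx : -(t * x) = -(x / (k * lam)) + q / k := by
    rw [ht, hu]; field_simp; ring
  rw [← htx, ← h1u, ← mul_assoc, Real.exp_neg, ← div_eq_mul_inv, le_div_iff₀ (Real.exp_pos _),
    mul_comm]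
  exact hmarkov.trans hle

/-! ### Energy growth for frustration-free Hamiltonians -/

namespace SpinOp

variable {N d : ℕ}

/-- The weight of `v` above energy `x` in an eigenbasis of `H` bounds its spectral projection. -/
theorem norm_spectralProjGE_sq_le (H : SpinOp N d) (x : ℝ) {J : Type*} [Fintype J]
    (b : OrthonormalBasis J ℂ (SpinSpace N d)) (e : J → ℝ) (he : ∀ i, H (b i) = (e i : ℂ) • b i)
    (hH : IsSelfAdjoint H) (v : SpinSpace N d) :
    ‖H.spectralProjGE x v‖ ^ 2 ≤ ∑ i with x ≤ e i, ‖inner ℂ (b i) v‖ ^ 2 := by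
  have hsymm := ContinuousLinearMap.isSelfAdjoint_iff_isSymmetric.mp hH
  rw [← b.sum_sq_norm_inner_right, Finset.sum_filter]
  refine Finset.sum_le_sum fun i _ => ?_
  have hb : b i ∈ Module.End.eigenspace (H : SpinSpace N d →ₗ[ℂ] SpinSpace N d) (e i : ℂ) :=
    Module.End.mem_eigenspace_iff.mpr (he i)
  have hswap : inner ℂ (b i) (H.spectralProjGE x v) = inner ℂ (H.spectralProjGE x (b i)) v :=
    ((H.spectralSubspaceGE x).inner_starProjection_left_eq_right _ _).symm
  rw [hswap]
  split_ifs with h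
  · have hmem : b i ∈ H.spectralSubspaceGE x :=
      Submodule.mem_iSup_of_mem (e i) (Submodule.mem_iSup_of_mem h hb)
    rw [spectralProjGE, Submodule.starProjection_eq_self_iff.mpr hmem]
  · have hperp : b i ∈ (H.spectralSubspaceGE x)ᗮ := by
      have hle : H.spectralSubspaceGE x ≤
          (Module.End.eigenspace (H : SpinSpace N d →ₗ[ℂ] SpinSpace N d) (e i : ℂ))ᗮ := by
        refine iSup_le fun μ => iSup_le fun hμ => ?_
        have hne : (μ : ℂ) ≠ (e i : ℂ) := by
          intro hc
          exact h (Complex.ofReal_injective hc ▸ hμ)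
        intro w hw y hy
        simpa using hsymm.orthogonalFamily_eigenspaces hne.symm ⟨y, hy⟩ ⟨w, hw⟩
      rw [Submodule.mem_orthogonal']
      exact fun u hu => hle hu _ hb
    rw [spectralProjGE, (Submodule.starProjection_apply_eq_zero_iff _).mpr hperp]
    simp

/-- The local term `h X` normalized to have norm at most one. -/
noncomputable def normalized (h : Finset (Fin N) → SpinOp N d) (X : Finset (Fin N)) : SpinOp N d :=
  ((‖h X‖⁻¹ : ℝ) : ℂ) • h X

theorem norm_normalized_le (h : Finset (Fin N) → SpinOp N d) (X : Finset (Fin N)) :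
    ‖normalized h X‖ ≤ 1 := by
  rw [normalized, norm_smul, Complex.norm_real, norm_inv, norm_norm]
  exact inv_mul_le_one

theorem norm_smul_normalized (h : Finset (Fin N) → SpinOp N d) (X : Finset (Fin N)) :
    (‖h X‖ : ℂ) • normalized h X = h X := by
  by_cases h0 : h X = 0
  · rw [h0, norm_zero, Complex.ofReal_zero]
    exact zero_smul ℂ (normalized h X)
  · rw [normalized, smul_smul, ← Complex.ofReal_mul, mul_inv_cancel₀ (norm_ne_zero_iff.mpr h0)]
    simp

theorem IsLocalDecomposition.commute_normalized {k : ℕ} {H : SpinOp N d}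
    {h : Finset (Fin N) → SpinOp N d} (hH : IsLocalDecomposition k H h) (X Y : Finset (Fin N))
    (hXY : Disjoint X Y) : Commute (normalized h X) (normalized h Y) :=
  ((hH.supported X).smul _).commute ((hH.supported Y).smul _) hXY

theorem IsExtensive.sum_meeting_le {g : ℝ} {h : Finset (Fin N) → SpinOp N d}
    (hg : IsExtensive g h) (X : Finset (Fin N)) :
    ∑ Y with ¬ Disjoint X Y, ‖h Y‖ ≤ X.card * g := by
  calc ∑ Y with ¬ Disjoint X Y, ‖h Y‖
      ≤ ∑ Y, ∑ i ∈ X, if i ∈ Y then ‖h Y‖ else 0 := by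
        rw [Finset.sum_filter]
        refine Finset.sum_le_sum fun Y _ => ?_
        by_cases hXY : Disjoint X Y
        · rw [if_neg (not_not_intro hXY)]
          exact Finset.sum_nonneg fun i _ => by split_ifs <;> positivity
        · rw [if_pos hXY]
          obtain ⟨i, hiX, hiY⟩ := Finset.not_disjoint_iff.mp hXY
          refine le_trans ?_ (Finset.single_le_sum (f := fun i => if i ∈ Y then ‖h Y‖ else 0)
            (fun i _ => by split_ifs <;> positivity) hiX)
          simp [hiY]
    _ = ∑ i ∈ X, ∑ Y with i ∈ Y, ‖h Y‖ := by
        rw [Finset.sum_comm]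
        simp_rw [Finset.sum_filter]
    _ ≤ ∑ _i ∈ X, g := Finset.sum_le_sum fun i _ => hg i
    _ = X.card * g := by simp

/-- `H` is the sum of the normalized terms with weights `‖h X‖`; a set of at most `k` spins meets
terms of total weight at most `g * k`. -/
theorem IsFrustrationFree.norm_apply_le {k : ℕ} {g : ℝ} (hg : 0 < g) {H : SpinOp N d}
    {h : Finset (Fin N) → SpinOp N d} {Ω : SpinSpace N d} (hH : IsFrustrationFree k g H h Ω)
    {n : ℕ} {φ : SpinSpace N d} (hφ : IsExcitedAtMost (normalized h) n φ) :
    ‖H φ‖ ≤ g * k * n * ‖φ‖ := by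
  have hloc := hH.isLocalDecomposition
  -- The empty set would break the peeling, being disjoint from itself; its weight can be dropped
  -- since its term kills `φ`.
  set w : Finset (Fin N) → ℝ := fun X => if X = ∅ then 0 else ‖h X‖ with hw
  have hwle : ∀ X, w X ≤ ‖h X‖ := fun X => by
    simp only [hw]
    split_ifs
    exacts [norm_nonneg _, le_rfl]
  have hsum : H φ = ∑ X, (w X : ℂ) • normalized h X φ := by
    conv_lhs => rw [hloc.sum_eq]
    rw [_root_.sum_apply]
    refine Finset.sum_congr rfl fun X _ => ?_
    have h1 : h X φ = (‖h X‖ : ℂ) • normalized h X φ := by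
      rw [← _root_.smul_apply, norm_smul_normalized]
    by_cases hX : X = ∅
    · have h2 : normalized h X φ = 0 := by
        simpa [hX] using hφ [∅] (by simp) (by simp)
      rw [h1, h2, smul_zero, smul_zero]
    · simp only [hw, if_neg hX, h1]
  rw [hsum]
  refine (norm_weighted_sum_le (normalized h) (fun X => ?_) hloc.commute_normalized
    (norm_normalized_le h) hφ w (fun X => ?_) (by simp [hw]) (g * k) (by positivity)
    (fun X hX => ?_)).trans_eq (by ring)
  · exact IsSelfAdjoint.smul (by simp [IsSelfAdjoint]) (hH.isSelfAdjoint X)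
  · simp only [hw]
    split_ifs <;> positivity
  · have hcard : X.card ≤ k := by
      by_contra! hlt
      simp [hw, hloc.eq_zero_of_lt_card X hlt] at hX
    calc ∑ Y with ¬ Disjoint X Y, w Y ≤ ∑ Y with ¬ Disjoint X Y, ‖h Y‖ :=
          Finset.sum_le_sum fun Y _ => hwle Y
      _ ≤ X.card * g := hH.isExtensive.sum_meeting_le X
      _ ≤ g * k := by rw [mul_comm]; gcongr

theorem IsLocalDecomposition.isExcitedAtMost_apply {k q : ℕ} {H A : SpinOp N d}
    {h a : Finset (Fin N) → SpinOp N d} (hH : IsLocalDecomposition k H h)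
    (hA : IsLocalDecomposition q A a) {n : ℕ} {φ : SpinSpace N d}
    (hφ : IsExcitedAtMost (normalized h) n φ) : IsExcitedAtMost (normalized h) (n + q) (A φ) := by
  rw [hA.sum_eq, _root_.sum_apply]
  refine IsExcitedAtMost.sum fun Z _ => ?_
  by_cases hZ : Z.card ≤ q
  · exact hφ.apply hH.commute_normalized (a Z) Z
      (fun X hX => ((hH.supported X).smul _).commute (hA.supported Z) hX.symm) (by omega)
  · rw [hA.eq_zero_of_lt_card Z (by omega)]
    exact IsExcitedAtMost.zero _ _

/-- After `j` applications of `H` there are at most `q + k * j` excitations, which bounds the gain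
of the next one. -/
theorem IsFrustrationFree.norm_pow_apply_le {k q : ℕ} {g : ℝ} (hg : 0 < g) {H : SpinOp N d}
    {h : Finset (Fin N) → SpinOp N d} {Ω : SpinSpace N d} (hH : IsFrustrationFree k g H h Ω)
    {ψ : SpinSpace N d} (hψ : IsExcitedAtMost (normalized h) q ψ) (m : ℕ) :
    ‖(H ^ m) ψ‖ ≤ (∏ j ∈ Finset.range m, (g * k * (q + k * j))) * ‖ψ‖ := by
  have hloc := hH.isLocalDecomposition
  have hexc : ∀ m : ℕ, IsExcitedAtMost (normalized h) (q + m * k) ((H ^ m) ψ) := by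
    intro m
    induction m with
    | zero => simpa using hψ
    | succ m ih =>
      rw [pow_succ', add_mul, one_mul, ← add_assoc]
      exact hloc.isExcitedAtMost_apply hloc ih
  induction m with
  | zero => simp
  | succ m ih =>
    rw [pow_succ', Finset.prod_range_succ]
    change ‖H ((H ^ m) ψ)‖ ≤ _
    refine (hH.norm_apply_le hg (hexc m)).trans ?_
    refine (mul_le_mul_of_nonneg_left ih (by positivity)).trans_eq ?_
    push_cast
    ring

end SpinOp

/-! ### The tail bound -/

theorem mainTheorem4 {N d : ℕ} (k q : ℕ) (hk : 0 < k) (hq : 0 < q) (g : ℝ) (hg : 0 < g)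
    (H : SpinOp N d) (h : Finset (Fin N) → SpinOp N d) (Ω : SpinSpace N d)
    (hH : SpinOp.IsFrustrationFree k g H h Ω)
    (A : SpinOp N d) (hA : SpinOp.IsLocal q A)
    (x : ℝ) (hx : energyScale g k * q ≤ x) :
    ‖H.spectralProjGE x (A Ω)‖ ≤
      ‖A Ω‖ * (x / (energyScale g k * q)) ^ ((q : ℝ) / (2 * k)) *
        Real.exp (-(x / (2 * k * energyScale g k)) + q / (2 * k)) := by
  obtain ⟨a, ha⟩ := hA
  have hloc := hH.isLocalDecomposition
  set ψ := A Ω with hψdef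
  have hk' : (0 : ℝ) < k := by exact_mod_cast hk
  have hq' : (0 : ℝ) < q := by exact_mod_cast hq
  have hlam : 0 < energyScale g k := by unfold energyScale; positivity
  have hψ : IsExcitedAtMost (SpinOp.normalized h) q ψ := by
    have h0 : IsExcitedAtMost (SpinOp.normalized h) 0 Ω :=
      IsExcitedAtMost.of_apply_eq_zero hloc.commute_normalized fun X => by
        simp [SpinOp.normalized, hH.apply_eq_zero X]
    simpa using hloc.isExcitedAtMost_apply ha h0
  have hsa : IsSelfAdjoint H := by
    rw [hloc.sum_eq]
    exact isSelfAdjoint_sum (R := SpinOp N d) _ fun X _ => hH.isSelfAdjoint X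
  have hsymm := ContinuousLinearMap.isSelfAdjoint_iff_isSymmetric.mp hsa
  set b := hsymm.eigenvectorBasis rfl
  set e := hsymm.eigenvalues rfl
  have he : ∀ i, H (b i) = (e i : ℂ) • b i := fun i => hsymm.apply_eigenvectorBasis rfl i
  have hpow : ∀ (m : ℕ) i, inner ℂ (b i) ((H ^ m) ψ) = (e i : ℂ) ^ m * inner ℂ (b i) ψ := by
    intro m i
    induction m with
    | zero => simp
    | succ m ih =>
      rw [pow_succ']
      change inner ℂ (b i) (H ((H ^ m) ψ)) = _
      have : inner ℂ (b i) (H ((H ^ m) ψ)) = inner ℂ (H (b i)) ((H ^ m) ψ) :=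
        (hsymm _ _).symm
      rw [this, he, inner_smul_left, ih, Complex.conj_ofReal, pow_succ']
      ring
  have hmom : ∀ m : ℕ, ∑ i, ‖inner ℂ (b i) ψ‖ ^ 2 * e i ^ m ≤
      ‖ψ‖ ^ 2 * ∏ j ∈ Finset.range m, (energyScale g k * (q + k * j)) := by
    intro m
    have h1 : inner ℂ ψ ((H ^ m) ψ) = ((∑ i, ‖inner ℂ (b i) ψ‖ ^ 2 * e i ^ m : ℝ) : ℂ) := by
      rw [← b.sum_inner_mul_inner, Complex.ofReal_sum]
      refine Finset.sum_congr rfl fun i _ => ?_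
      rw [Complex.ofReal_mul, Complex.ofReal_pow, Complex.ofReal_pow]
      rw [hpow, ← inner_conj_symm ψ (b i), ← Complex.conj_mul']
      ring
    calc ∑ i, ‖inner ℂ (b i) ψ‖ ^ 2 * e i ^ m ≤ ‖inner ℂ ψ ((H ^ m) ψ)‖ := by
          rw [h1, Complex.norm_real]
          exact le_abs_self _
      _ ≤ ‖ψ‖ * ‖(H ^ m) ψ‖ := norm_inner_le_norm _ _
      _ ≤ ‖ψ‖ * ((∏ j ∈ Finset.range m, (g * k * (q + k * j))) * ‖ψ‖) := by
          gcongr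
          exact hH.norm_pow_apply_le hg hψ m
      _ = ‖ψ‖ ^ 2 * ∏ j ∈ Finset.range m, (g * k * (q + k * j)) := by ring
      -- The argument gives the scale `g * k`; a factor of two is given away here.
      _ ≤ _ := by
          gcongr with j _
          unfold energyScale
          nlinarith [mul_pos hg hk']
  have hmain := (H.norm_spectralProjGE_sq_le x b e he hsa ψ).trans
    (sum_filter_le_of_moments (fun i => ‖inner ℂ (b i) ψ‖ ^ 2) e (fun i => by positivity)
      hlam hk' hq' hmom hx)
  have hr : 0 ≤ x / (energyScale g k * q) :=
    div_nonneg ((by positivity : 0 ≤ energyScale g k * q).trans hx) (by positivity)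
  -- The tail bound controls the squared norm, so the square root halves both exponents.
  refine le_of_sq_le_sq (hmain.trans_eq ?_) (by positivity)
  rw [mul_pow, mul_pow, ← Real.exp_nat_mul, ← Real.rpow_mul_natCast hr, mul_assoc]
  congr 3
  · push_cast; field_simp
  · push_cast; field_simp
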